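/- Let $G$ be a nontrivial finite group. In the three-player game \emph{Do Not Generate} on $G$, Players 1, 2, 3 take turns cyclically (Player 1 first) selecting previously unselected elements of $G$. The game ends as soon as the jointly selected elements generate $G$: the player who made that last selection loses, the player who moves immediately before the loser in the cyclic order is the winner, and the remaining player is the runner-up. Every player prefers winning to being the runner-up and being the runner-up to losing. We say that Player $i$ \emph{has a winning strategy} if Player $i$ wins under rational play, that is, if the game has a subgame perfect equilibrium and Player $i$ wins in every subgame perfect equilibrium. For a finite group $X$ let $d(X)$ be the least size of a generating set of $X$. Let $G$ be a nontrivial finite nilpotent group, let $H$ be the (internal direct) product of the Sylow $q$-subgroups of $G$ over the primes $q \equiv 1 \pmod 3$, and let $K$ be the product of the Sylow $r$-subgroups of $G$ over the primes $r \equiv 2 \pmod 3$. 1. Player 1 has a winning strategy in each of the following cases: (a) $|G| \equiv 1 \pmod 3$ and $2d(H) \ge d(K)+1$; (b) $|G| \equiv 2 \pmod 3$ and $2d(K) \ge d(H)+1$; (c) $|G| \equiv 3 \pmod 9$ and $d(G) = 1$. 2. Player 2 has a winning strategy in each of the following cases: (a) $|G| \equiv 1 \pmod 3$ and $2d(H)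 < d(K)+1$; (b) $|G| \equiv 2 \pmod 3$ and $2d(K) < d(H)+1$; (c) $|G| \equiv 6 \pmod 9$ and $d(G) \le 2$. 3. Player 3 has a winning strategy in each of the following cases: (a) $|G| \equiv 0 \pmod 9$; (b) $|G| \equiv 3 \pmod 9$ and $d(G) \ge 2$; (c) $|G| \equiv 6 \pmod 9$ and $d(G) \ge 3$. -/

import Mathlib

namespace DoNotGenerate

/-- The three players: Player `k` is the residue class of `k` modulo `3`
(so Player 3 is `3 = 0`), and they move in the cyclic order `1, 2, 3, 1, 2, 3, …`. -/
abbrev Player : Type := ZMod 3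

/-- A history of a game that is still running: the list of the elements selected so far (latest
first), without repetitions, which do not jointly generate the group. -/
structure Position (G : Type*) [Group G] where
  selected : List G
  nodup : selected.Nodup
  not_generating : Subgroup.closure {x | x ∈ selected} ≠ ⊤

namespace Position

variable {G : Type*} [Group G]

/-- The beginning of the game: nothing has been selected. -/
def start (G : Type*) [Group G] [Nontrivial G] : Position G where
  selected := []
  nodup := List.nodup_nil
  not_generating := by simp [bot_ne_top]

/-- The player to move: after `n` selections this is Player `n + 1` (cyclically). -/
def toMove (h : Position G) : Player := (h.selected.length : ZMod 3) + 1

/-- The position after a legal selection that does not generate the group. -/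
def extend (h : Position G) (x : G) (hx : x ∉ h.selected)
    (hgen : Subgroup.closure {y | y ∈ x :: h.selected} ≠ ⊤) : Position G where
  selected := x :: h.selected
  nodup := List.nodup_cons.2 ⟨hx, h.nodup⟩
  not_generating := hgen

theorem extend_measure_lt [Finite G] (h : Position G) (x : G) (hx : x ∉ h.selected)
    (hgen : Subgroup.closure {y | y ∈ x :: h.selected} ≠ ⊤) :
    Nat.card G - (h.extend x hx hgen).selected.length < Nat.card G - h.selected.length := by
  have := Fintype.ofFinite G
  have h1 := (h.extend x hx hgen).nodup.length_le_card
  rw [← Nat.card_eq_fintype_card] at h1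
  simp only [extend, List.length_cons] at h1 ⊢
  omega

end Position

/-- A strategy chooses, at every history of a running game, a previously unselected element
(which may be one that completes a generating set). Only the choices at the positions where it is
the owner's turn are ever used. -/
structure Strategy (G : Type*) [Group G] where
  move : Position G → G
  legal : ∀ h : Position G, move h ∉ h.selected

/-- A strategy for each of the three players. -/
abbrev Profile (G : Type*) [Group G] : Type _ := Player → Strategy G

open Classical in
/-- The winner when the game is continued from the position `h` and all players follow `σ`.
The player whose selection completes a generating set loses, and the player who moves immediately
before the loser (in cyclic order) is the winner. -/
noncomputable def winner {G : Type*} [Group G] [Finite G] (σ : Profile G) (h : Position G) :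
    Player :=
  if hgen : Subgroup.closure {y | y ∈ (σ h.toMove).move h :: h.selected} = ⊤ then
    h.toMove - 1
  else
    winner σ (h.extend ((σ h.toMove).move h) ((σ h.toMove).legal h) hgen)
termination_by Nat.card G - h.selected.length
decreasing_by exact h.extend_measure_lt _ _ _

/-- How player `i` ranks the outcome of a game won by `w`: winning is best (`2`), being the
runner-up is second best (`1`), losing is worst (`0`). The loser is `w + 1`, so the runner-up, the
remaining player, is `w - 1`. -/
def payoff (i w : Player) : ℕ :=
  if i = w then 2 else if i = w - 1 then 1 else 0

/-- All players play rationally: at no position, reached or not, can a player obtain an outcome she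
prefers by changing her own strategy (subgame perfect equilibrium). -/
def IsRational {G : Type*} [Group G] [Finite G] (σ : Profile G) : Prop :=
  ∀ (h : Position G) (i : Player) (τ : Strategy G),
    payoff i (winner (Function.update σ i τ) h) ≤ payoff i (winner σ h)

/-- Player `i` has a winning strategy in the three-player game *Do Not Generate* on `G`, where every
player helps her preferred opponent if she cannot win herself: rational play exists, and `i` wins
whenever everybody plays rationally. -/
def HasWinningStrategy (G : Type*) [Group G] [Finite G] [Nontrivial G] (i : Player) : Prop :=
  (∃ σ : Profile G, IsRational σ) ∧
    ∀ σ : Profile G, IsRational σ → winner σ (Position.start G) = i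

/-- The product in `G` of all Sylow `q`-subgroups of `G` for the primes `q ≡ c (mod 3)`. -/
def sylowProduct (G : Type*) [Group G] (c : ℕ) : Subgroup G :=
  ⨆ (q : ℕ) (_ : q.Prime) (_ : q ≡ c [MOD 3]) (P : Sylow q G), (P : Subgroup G)

end DoNotGenerate

/-! Ending the game is the worst outcome for the mover, so rational play can be taken to last until
some maximal subgroup `M` is exhausted. The next player must then lose, and the winner is `|M|` mod
3 (`exists_isCoatom_value`). Since nobody is indifferent between two winners, backward induction
(`value`) predicts the winner of every equilibrium (`IsRational.winner_eq_value`).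

In a nilpotent group `M` has prime index `p` and contains every Sylow subgroup for the other primes,
so `|M|` mod 3 depends on `p` alone. If 9 divides `|G|`, then 3 divides every `|M|` and Player 3
wins. Otherwise the primes fall into two classes, `G` is the product of the Hall subgroups `A` and
`B`, and whichever is generated first fixes the winner (`IsRace`). Progress is measured by
`relRank`: a selection lowers each count by at most one, and while both factors are incomplete the
mover can lower either count, leaving the other unchanged (`IsRace.exists_extend`).

If 3 does not divide `|G|`, the possible winners are 1 and 2. Player 3 prefers 1, being then the
runner-up, so two players push `A` against one pushing `B`; this is the source of the factor 2
(`IsRace.value_eq_one`, `IsRace.value_eq_two`). If 3 divides `|G|` exactly once, `B` has order 3 and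
one selection completes it. Hence `A` must be completed before someone who prefers `B` moves: that
is Player 2 for 3 mod 9, and Player 3 for 6 mod 9. -/

namespace DoNotGenerate

/-! ### Hall decompositions of nilpotent groups by power maps -/

section Splitting

variable {G : Type*} [Group G]

/-- The join of all Sylow `q`-subgroups over the primes `q` that satisfy `c`. -/
def hallProduct (G : Type*) [Group G] (c : ℕ → Prop) : Subgroup G :=
  ⨆ (q : ℕ) (_ : q.Prime) (_ : c q) (P : Sylow q G), (P : Subgroup G)

theorem sylow_le_hallProduct {c : ℕ → Prop} {q : ℕ} (hq : q.Prime) (hc : c q) (P : Sylow q G) :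
    (P : Subgroup G) ≤ hallProduct G c :=
  le_iSup_of_le q <| le_iSup_of_le hq <| le_iSup_of_le hc <| le_iSup_of_le P le_rfl

theorem hallProduct_le {c : ℕ → Prop} {L : Subgroup G}
    (h : ∀ q : ℕ, q.Prime → c q → ∀ P : Sylow q G, (P : Subgroup G) ≤ L) :
    hallProduct G c ≤ L :=
  iSup_le fun q => iSup_le fun hq => iSup_le fun hc => iSup_le fun P => h q hq hc P

/-- A decomposition of `G` as the internal product of `A` and `B` whose two projections are given
by taking powers, so that every subgroup is stable under them. -/
structure PowerSplit (A B : Subgroup G) where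
  fst : G →* G
  snd : G →* G
  fst_mem_zpowers : ∀ x, fst x ∈ Subgroup.zpowers x
  snd_mem_zpowers : ∀ x, snd x ∈ Subgroup.zpowers x
  fst_mul_snd : ∀ x, fst x * snd x = x
  fst_mem : ∀ x, fst x ∈ A
  snd_mem : ∀ x, snd x ∈ B
  fst_eq_one : ∀ x ∈ B, fst x = 1
  snd_eq_one : ∀ x ∈ A, snd x = 1

namespace PowerSplit

variable {A B : Subgroup G}

/-- The same decomposition with the factors interchanged. -/
def symm (s : PowerSplit A B) : PowerSplit B A where
  fst := s.snd
  snd := s.fst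
  fst_mem_zpowers := s.snd_mem_zpowers
  snd_mem_zpowers := s.fst_mem_zpowers
  fst_mul_snd x := by
    obtain ⟨m, hm⟩ := s.fst_mem_zpowers x
    obtain ⟨n, hn⟩ := s.snd_mem_zpowers x
    have h := s.fst_mul_snd x
    simp only at hm hn
    rw [← hm, ← hn] at h ⊢
    rw [← zpow_add] at h ⊢
    rwa [add_comm]
  fst_mem := s.snd_mem
  snd_mem := s.fst_mem
  fst_eq_one := s.snd_eq_one
  snd_eq_one := s.fst_eq_one

theorem fst_eq_self (s : PowerSplit A B) {x : G} (hx : x ∈ A) : s.fst x = x := by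
  have := s.fst_mul_snd x
  rwa [s.snd_eq_one x hx, mul_one] at this

theorem map_fst_le (s : PowerSplit A B) (C : Subgroup G) : C.map s.fst ≤ C := by
  rintro _ ⟨x, hx, rfl⟩
  exact (Subgroup.zpowers_le.2 hx) (s.fst_mem_zpowers x)

theorem map_fst_eq_bot (s : PowerSplit A B) {C : Subgroup G} (hC : C ≤ B) :
    C.map s.fst = ⊥ := by
  rw [eq_bot_iff]
  rintro _ ⟨x, hx, rfl⟩
  exact s.fst_eq_one x (hC hx)

theorem le_map_fst (s : PowerSplit A B) {C : Subgroup G} (hC : A ≤ C) : A ≤ C.map s.fst :=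
  fun x hx => ⟨x, hC hx, s.fst_eq_self hx⟩

theorem eq_top_of_le (s : PowerSplit A B) {C : Subgroup G} (hA : A ≤ C) (hB : B ≤ C) : C = ⊤ := by
  rw [eq_top_iff]
  intro x _
  rw [← s.fst_mul_snd x]
  exact C.mul_mem (hA (s.fst_mem x)) (hB (s.snd_mem x))

/-- Elements of the second factor do not help to reach the first factor. -/
theorem le_of_le_sup (s : PowerSplit A B) {C D : Subgroup G} (hD : D ≤ B) (h : A ≤ C ⊔ D) :
    A ≤ C := by
  have h1 := s.le_map_fst h
  rw [Subgroup.map_sup, s.map_fst_eq_bot hD, sup_bot_eq] at h1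
  exact h1.trans (s.map_fst_le C)

/-- If `B` is not inside `M`, then `M` and `B` generate `G`; as `B` contributes nothing towards `A`,
already `M` contains `A`. -/
theorem le_or_le_of_isCoatom (s : PowerSplit A B) {M : Subgroup G} (hM : IsCoatom M) :
    A ≤ M ∨ B ≤ M := by
  by_contra! h
  have h1 : M ⊔ B = ⊤ := hM.2 _ (lt_of_le_of_ne le_sup_left fun e => h.2 (e ▸ le_sup_right))
  exact h.1 (s.le_of_le_sup le_rfl (h1 ▸ le_top))

end PowerSplit

/-- Maximal subgroups of a nilpotent group are normal, and the quotient has no proper nontrivial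
subgroup, so the element of prime order from Cauchy's theorem generates it. -/
theorem prime_index_of_isCoatom [Finite G] [Group.IsNilpotent G] {M : Subgroup G}
    (hM : IsCoatom M) : M.index.Prime := by
  have : M.Normal := ((Group.isNilpotent_of_finite_tfae (G := G)).out 0 2 rfl rfl).mp ‹_› M hM
  have hne : M.index ≠ 1 := fun h => hM.1 (Subgroup.index_eq_one.1 h)
  obtain ⟨p, hp, hdvd⟩ := Nat.exists_prime_and_dvd hne
  have := Fact.mk hp
  obtain ⟨x, hx⟩ := exists_prime_orderOf_dvd_card' (G := G ⧸ M) p hdvd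
  have htop : (Subgroup.zpowers x).comap (QuotientGroup.mk' M) = ⊤ := by
    apply hM.2
    obtain ⟨g, rfl⟩ := QuotientGroup.mk'_surjective M x
    refine lt_of_le_of_ne (fun y hy => ?_) fun e => ?_
    · have : QuotientGroup.mk' M y = 1 := (QuotientGroup.eq_one_iff y).2 hy
      rw [Subgroup.mem_comap, this]
      exact Subgroup.one_mem _
    · have hg : g ∈ M := by
        rw [e]
        exact Subgroup.mem_zpowers _
      have : QuotientGroup.mk' M g = 1 := (QuotientGroup.eq_one_iff g).2 hg
      rw [this, orderOf_one] at hx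
      exact hp.one_lt.ne hx
  have hz : Subgroup.zpowers x = ⊤ := by
    rw [eq_top_iff]
    intro y _
    obtain ⟨g, rfl⟩ := QuotientGroup.mk'_surjective M y
    have : g ∈ (Subgroup.zpowers x).comap (QuotientGroup.mk' M) := htop ▸ Subgroup.mem_top g
    exact this
  have : M.index = p := by
    rw [← hx, ← Nat.card_zpowers, hz, Subgroup.card_top, Subgroup.index]
  rwa [this]

/-- A maximal subgroup containing the Sylow subgroups for the primes in `c` has index outside
`c`. -/
theorem not_index_of_hallProduct_le [Finite G] [Group.IsNilpotent G] {c : ℕ → Prop}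
    {M : Subgroup G} (hM : IsCoatom M) (hle : hallProduct G c ≤ M) : ¬ c M.index := by
  intro hc
  have hp := prime_index_of_isCoatom hM
  have := Fact.mk hp
  let P : Sylow M.index G := default
  have hP : (P : Subgroup G) ≤ M := (sylow_le_hallProduct hp hc P).trans hle
  exact P.not_dvd_index (Subgroup.index_dvd_of_le hP)

theorem hallProduct_sup_eq_top [Finite G] [Group.IsNilpotent G] {c c' : ℕ → Prop}
    (hc : ∀ q : ℕ, q.Prime → q ∣ Nat.card G → (c q ∨ c' q)) :
    hallProduct G c ⊔ hallProduct G c' = ⊤ := by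
  rcases eq_top_or_exists_le_coatom (hallProduct G c ⊔ hallProduct G c') with h | ⟨M, hM, hle⟩
  · exact h
  · have h1 := not_index_of_hallProduct_le hM (le_sup_left.trans hle)
    have h2 := not_index_of_hallProduct_le hM (le_sup_right.trans hle)
    exact ((hc _ (prime_index_of_isCoatom hM) M.index_dvd_card).elim h1 h2).elim

/-- The exponents are the Chinese remainder idempotents for `|G| = m * m'`, where `m` collects the
prime powers in `c` and `m'` the others. -/
theorem exists_pow_split [Finite G] [Group.IsNilpotent G] (c : ℕ → Prop) :
    ∃ e f : ℕ, (∀ x y : G, (x * y) ^ e = x ^ e * y ^ e) ∧ (∀ x y : G, (x * y) ^ f = x ^ f * y ^ f) ∧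
      (∀ x : G, x ^ e * x ^ f = x) ∧
      ∀ q : ℕ, q.Prime → ∀ P : Sylow q G, ∀ x ∈ P,
        (c q → x ^ e = x ∧ x ^ f = 1) ∧ (¬ c q → x ^ e = 1 ∧ x ^ f = x) := by
  classical
  set n := Nat.card G with hn
  have hn0 : n ≠ 0 := Nat.card_pos.ne'
  set m := ∏ p ∈ n.primeFactors with c p, p ^ n.factorization p with hm
  set m' := ∏ p ∈ n.primeFactors with ¬ c p, p ^ n.factorization p with hm'
  have hmul : m * m' = n := by
    rw [hm, hm', Finset.prod_filter_mul_prod_filter_not]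
    exact Nat.prod_factorization_pow_eq_self hn0
  have hcop : Nat.Coprime m m' := by
    refine Nat.Coprime.prod_left fun p hp => Nat.Coprime.prod_right fun q hq => ?_
    rw [Finset.mem_filter] at hp hq
    refine Nat.Coprime.pow _ _ ((Nat.coprime_primes (Nat.prime_of_mem_primeFactors hp.1)
      (Nat.prime_of_mem_primeFactors hq.1)).2 ?_)
    rintro rfl
    exact hq.2 hp.2
  obtain ⟨e, he1, he0⟩ := Nat.chineseRemainder hcop 1 0
  obtain ⟨f, hf0, hf1⟩ := Nat.chineseRemainder hcop 0 1
  have hord : ∀ q : ℕ, q.Prime → ∀ P : Sylow q G, ∀ x ∈ P,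
      (c q → orderOf x ∣ m) ∧ (¬ c q → orderOf x ∣ m') := by
    intro q hq P x hx
    have := Fact.mk hq
    have h1 : orderOf x ∣ q ^ n.factorization q := by
      rw [hn, ← P.card_eq_multiplicity]
      exact Subgroup.orderOf_dvd_natCard _ hx
    by_cases hqn : q ∈ n.primeFactors
    · exact ⟨fun hc => h1.trans (Finset.dvd_prod_of_mem (fun p => p ^ n.factorization p)
          (Finset.mem_filter.2 ⟨hqn, hc⟩)),
        fun hc => h1.trans (Finset.dvd_prod_of_mem (fun p => p ^ n.factorization p)
          (Finset.mem_filter.2 ⟨hqn, hc⟩))⟩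
    · rw [← Nat.support_factorization, Finsupp.notMem_support_iff] at hqn
      rw [hqn, pow_zero] at h1
      exact ⟨fun _ => h1.trans (one_dvd _), fun _ => h1.trans (one_dvd _)⟩
  have hpow1 : ∀ {x : G} {k l : ℕ}, orderOf x ∣ l → k ≡ 1 [MOD l] → x ^ k = x := by
    intro x k l hx hk
    conv_rhs => rw [← pow_one x]
    exact pow_eq_pow_iff_modEq.2 (hk.of_dvd hx)
  have hpow0 : ∀ {x : G} {k l : ℕ}, orderOf x ∣ l → k ≡ 0 [MOD l] → x ^ k = 1 := by
    intro x k l hx hk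
    rw [← pow_zero x]
    exact pow_eq_pow_iff_modEq.2 (hk.of_dvd hx)
  have hsyl : ∀ q : ℕ, q.Prime → ∀ P : Sylow q G, ∀ x ∈ P,
        (c q → x ^ e = x ∧ x ^ f = 1) ∧ (¬ c q → x ^ e = 1 ∧ x ^ f = x) := by
    intro q hq P x hx
    obtain ⟨h1, h2⟩ := hord q hq P x hx
    exact ⟨fun hc => ⟨hpow1 (h1 hc) he1, hpow0 (h1 hc) hf0⟩,
      fun hc => ⟨hpow0 (h2 hc) he0, hpow1 (h2 hc) hf1⟩⟩
  obtain ⟨φ⟩ := ((Group.isNilpotent_of_finite_tfae (G := G)).out 0 4).mp ‹_›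
  -- Power maps need not be homomorphisms, but these are: on each Sylow coordinate of `G` they are
  -- the identity or trivial.
  have hhom : ∀ k : ℕ, (∀ q : ℕ, q.Prime → ∀ P : Sylow q G,
      (∀ x ∈ P, x ^ k = x) ∨ (∀ x ∈ P, x ^ k = 1)) → ∀ x y : G, (x * y) ^ k = x ^ k * y ^ k := by
    intro k hk x y
    apply φ.symm.injective
    simp only [map_mul, map_pow]
    funext p P
    have := hk p (Nat.prime_of_mem_primeFactors p.2) P
    simp only [Pi.mul_apply, Pi.pow_apply]
    apply Subtype.ext
    simp only [Subgroup.coe_mul, Subgroup.coe_pow]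
    rcases this with h | h
    · rw [h _ (φ.symm x p P).2, h _ (φ.symm y p P).2,
        h _ (mul_mem (φ.symm x p P).2 (φ.symm y p P).2)]
    · rw [h _ (φ.symm x p P).2, h _ (φ.symm y p P).2,
        h _ (mul_mem (φ.symm x p P).2 (φ.symm y p P).2), one_mul]
  refine ⟨e, f, hhom e fun q hq P => ?_, hhom f fun q hq P => ?_, fun x => ?_, hsyl⟩
  · by_cases hc : c q
    · exact Or.inl fun x hx => ((hsyl q hq P x hx).1 hc).1
    · exact Or.inr fun x hx => ((hsyl q hq P x hx).2 hc).1
  · by_cases hc : c q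
    · exact Or.inr fun x hx => ((hsyl q hq P x hx).1 hc).2
    · exact Or.inl fun x hx => ((hsyl q hq P x hx).2 hc).2
  · rw [← pow_add]
    refine hpow1 (l := m * m') (hmul ▸ orderOf_dvd_natCard x) ?_
    exact (Nat.modEq_and_modEq_iff_modEq_mul hcop).1 ⟨he1.add hf0, he0.add hf1⟩

/-- A finite nilpotent group is the product of its Hall subgroups for two complementary sets of
primes. -/
theorem nonempty_powerSplit_hallProduct [Finite G] [Group.IsNilpotent G] {c c' : ℕ → Prop}
    (hc : ∀ q : ℕ, q.Prime → q ∣ Nat.card G → (c' q ↔ ¬ c q)) :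
    Nonempty (PowerSplit (hallProduct G c) (hallProduct G c')) := by
  obtain ⟨e, f, he, hf, hef, hsyl⟩ := exists_pow_split (G := G) c
  let E : G →* G := { toFun := fun x => x ^ e, map_one' := one_pow e, map_mul' := he }
  let F : G →* G := { toFun := fun x => x ^ f, map_one' := one_pow f, map_mul' := hf }
  -- For primes not dividing `|G|`, where `hc` says nothing, the Sylow subgroup is trivial.
  have hsyl' : ∀ q : ℕ, q.Prime → c' q → ∀ P : Sylow q G, ∀ x ∈ P, x ^ e = 1 ∧ x ^ f = x := by
    intro q hq hcq P x hx
    by_cases hd : q ∣ Nat.card G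
    · exact (hsyl q hq P x hx).2 ((hc q hq hd).1 hcq)
    · have := Fact.mk hq
      have h1 : orderOf x ∣ Nat.card P := Subgroup.orderOf_dvd_natCard _ hx
      rw [P.card_eq_multiplicity, Nat.factorization_eq_zero_of_not_dvd hd, pow_zero,
        Nat.dvd_one, orderOf_eq_one_iff] at h1
      simp [h1]
  have hE0 : hallProduct G c' ≤ E.ker :=
    hallProduct_le fun q hq hcq P x hx => (hsyl' q hq hcq P x hx).1
  have hF0 : hallProduct G c ≤ F.ker :=
    hallProduct_le fun q hq hcq P x hx => ((hsyl q hq P x hx).1 hcq).2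
  have hE1 : (hallProduct G c).map E ≤ hallProduct G c :=
    Subgroup.map_le_iff_le_comap.2 <| hallProduct_le fun q hq hcq P x hx => by
      change x ^ e ∈ hallProduct G c
      rw [((hsyl q hq P x hx).1 hcq).1]
      exact sylow_le_hallProduct hq hcq P hx
  have hF1 : (hallProduct G c').map F ≤ hallProduct G c' :=
    Subgroup.map_le_iff_le_comap.2 <| hallProduct_le fun q hq hcq P x hx => by
      change x ^ f ∈ hallProduct G c'
      rw [(hsyl' q hq hcq P x hx).2]
      exact sylow_le_hallProduct hq hcq P hx
  have htop : hallProduct G c ⊔ hallProduct G c' = ⊤ :=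
    hallProduct_sup_eq_top fun q hq hd => by
      rw [hc q hq hd]
      exact em _
  refine ⟨⟨E, F, fun x => ⟨e, zpow_natCast x e⟩, fun x => ⟨f, zpow_natCast x f⟩, hef,
    fun x => ?_, fun x => ?_, fun x hx => hE0 hx, fun x hx => hF0 hx⟩⟩
  · have h : E x ∈ (hallProduct G c ⊔ hallProduct G c').map E :=
      ⟨x, htop ▸ Subgroup.mem_top x, rfl⟩
    rw [Subgroup.map_sup, (Subgroup.map_eq_bot_iff _).2 hE0, sup_bot_eq] at h
    exact hE1 h
  · have h : F x ∈ (hallProduct G c ⊔ hallProduct G c').map F :=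
      ⟨x, htop ▸ Subgroup.mem_top x, rfl⟩
    rw [Subgroup.map_sup, (Subgroup.map_eq_bot_iff _).2 hF0, bot_sup_eq] at h
    exact hF1 h

end Splitting

/-! ### Generators still missing from a factor -/

section RelativeRank

variable {G : Type*} [Group G]

/-- The least number of elements of `G` which together with `C` generate a subgroup that
contains `A`. -/
noncomputable def relRank (A C : Subgroup G) : ℕ :=
  sInf {n | ∃ T : Finset G, T.card = n ∧ A ≤ C ⊔ Subgroup.closure (T : Set G)}

theorem relRank_le {A C : Subgroup G} (T : Finset G) (h : A ≤ C ⊔ Subgroup.closure (T : Set G)) :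
    relRank A C ≤ T.card :=
  Nat.sInf_le ⟨T, rfl, h⟩

variable [Finite G]

theorem exists_relRank (A C : Subgroup G) :
    ∃ T : Finset G, T.card = relRank A C ∧ A ≤ C ⊔ Subgroup.closure (T : Set G) := by
  have := Fintype.ofFinite G
  exact Nat.sInf_mem (s := {n | ∃ T : Finset G, T.card = n ∧ A ≤ C ⊔ Subgroup.closure (T : Set G)})
    ⟨_, Finset.univ, rfl, by simp⟩

theorem relRank_eq_zero {A C : Subgroup G} : relRank A C = 0 ↔ A ≤ C := by
  constructor
  · intro h
    obtain ⟨T, hT, hle⟩ := exists_relRank A C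
    rw [h, Finset.card_eq_zero] at hT
    simpa [hT] using hle
  · intro h
    simpa using relRank_le (A := A) (C := C) ∅ (by simpa using h)

theorem relRank_anti (A : Subgroup G) {C D : Subgroup G} (h : C ≤ D) :
    relRank A D ≤ relRank A C := by
  obtain ⟨T, hT, hle⟩ := exists_relRank A C
  exact hT ▸ relRank_le T (hle.trans (sup_le_sup_right h _))

theorem relRank_le_succ (A C : Subgroup G) (x : G) :
    relRank A C ≤ relRank A (C ⊔ Subgroup.closure {x}) + 1 := by
  classical
  obtain ⟨T, hT, hle⟩ := exists_relRank A (C ⊔ Subgroup.closure {x})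
  rw [← hT]
  refine (relRank_le (insert x T) ?_).trans (Finset.card_insert_le _ _)
  rwa [Finset.coe_insert, Set.insert_eq, Subgroup.closure_union, ← sup_assoc]

variable {A B : Subgroup G}

theorem PowerSplit.relRank_sup (s : PowerSplit A B) {x : G} (hx : x ∈ B) (C : Subgroup G) :
    relRank A (C ⊔ Subgroup.closure {x}) = relRank A C := by
  refine le_antisymm (relRank_anti A le_sup_left) ?_
  obtain ⟨T, hT, hle⟩ := exists_relRank A (C ⊔ Subgroup.closure {x})
  rw [← hT]
  refine relRank_le T (s.le_of_le_sup (D := Subgroup.closure {x}) ?_ ?_)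
  · rwa [Subgroup.closure_le, Set.singleton_subset_iff]
  · rwa [sup_right_comm] at hle

/-- Projecting an optimal set to `A` keeps it sufficient, because the projection is a power map and
sends `C` into itself. -/
theorem PowerSplit.exists_relRank_subset (s : PowerSplit A B) (C : Subgroup G) :
    ∃ T : Finset G, T.card ≤ relRank A C ∧ (T : Set G) ⊆ A ∧
      A ≤ C ⊔ Subgroup.closure (T : Set G) := by
  classical
  obtain ⟨T, hT, hle⟩ := exists_relRank A C
  refine ⟨T.image s.fst, hT ▸ Finset.card_image_le, ?_, ?_⟩
  · intro y hy
    obtain ⟨x, -, rfl⟩ := Finset.mem_image.1 hy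
    exact s.fst_mem x
  · have h := s.le_map_fst hle
    rw [Subgroup.map_sup, MonoidHom.map_closure, ← Finset.coe_image] at h
    exact h.trans (sup_le_sup_right (s.map_fst_le C) _)

theorem PowerSplit.exists_relRank_lt (s : PowerSplit A B) {C : Subgroup G}
    (h : 0 < relRank A C) :
    ∃ x ∈ A, relRank A (C ⊔ Subgroup.closure {x}) < relRank A C := by
  classical
  obtain ⟨T, hT, hTA, hle⟩ := s.exists_relRank_subset C
  have hne : T.Nonempty := by
    rw [Finset.nonempty_iff_ne_empty]
    rintro rfl
    rw [Finset.coe_empty, Subgroup.closure_empty, sup_bot_eq] at hle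
    exact h.ne' (relRank_eq_zero.2 hle)
  obtain ⟨x, hx⟩ := hne
  refine ⟨x, hTA hx, lt_of_lt_of_le ?_ hT⟩
  refine lt_of_le_of_lt (relRank_le (T.erase x) ?_) (Finset.card_erase_lt_of_mem hx)
  rw [sup_assoc, ← Subgroup.closure_union, ← Set.insert_eq, ← Finset.coe_insert,
    Finset.insert_erase hx]
  exact hle

theorem PowerSplit.relRank_bot (s : PowerSplit A B) : relRank A ⊥ = Group.rank A := by
  classical
  apply le_antisymm
  · obtain ⟨T, hT, htop⟩ := Group.rank_spec A
    rw [← hT]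
    refine (relRank_le (T.image A.subtype) ?_).trans Finset.card_image_le
    rw [Finset.coe_image, ← MonoidHom.map_closure, htop, bot_sup_eq, ← MonoidHom.range_eq_map,
      Subgroup.range_subtype]
  · obtain ⟨T, hT, hTA, hle⟩ := s.exists_relRank_subset ⊥
    rw [bot_sup_eq] at hle
    have heq : Subgroup.closure (T : Set G) = A :=
      le_antisymm ((Subgroup.closure_le A).2 hTA) hle
    have h1 := Subgroup.rank_closure_finset_le_card T
    rw [Subgroup.rank_congr heq] at h1
    exact h1.trans hT

end RelativeRank

/-! ### Payoffs and positions -/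

section Position

variable {G : Type*} [Group G]

theorem payoff_self (p : Player) : payoff p p = 2 := by simp [payoff]

theorem payoff_add_one (p : Player) : payoff p (p + 1) = 1 := by
  revert p; decide

theorem payoff_sub_one (p : Player) : payoff p (p - 1) = 0 := by
  revert p; decide

/-- The absence of ties is what makes all equilibria agree on the winner. -/
theorem payoff_injective (p : Player) : Function.Injective (payoff p) := by
  revert p; decide

theorem player_cases (p w : Player) : w = p ∨ w = p + 1 ∨ w = p - 1 := by
  revert p w; decide

theorem Position.exists_notMem (h : Position G) : ∃ x, x ∉ h.selected := by
  by_contra! hall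
  apply h.not_generating
  rw [eq_top_iff]
  intro x _
  exact Subgroup.subset_closure (hall x)

/-- The subgroup generated by the elements selected so far. -/
def Position.span (h : Position G) : Subgroup G := Subgroup.closure {x | x ∈ h.selected}

theorem closure_cons (h : Position G) (x : G) :
    Subgroup.closure {y | y ∈ x :: h.selected} = h.span ⊔ Subgroup.closure {x} := by
  have : {y | y ∈ x :: h.selected} = {y | y ∈ h.selected} ∪ {x} := by
    ext y
    simp
  rw [this, Subgroup.closure_union, Position.span]

theorem Position.span_extend (h : Position G) (x : G) (hx hgen) :
    (h.extend x hx hgen).span = h.span ⊔ Subgroup.closure {x} :=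
  closure_cons h x

theorem Position.span_start [Nontrivial G] : (Position.start G).span = ⊥ := by
  simp [Position.span, Position.start]

theorem Position.toMove_start [Nontrivial G] : (Position.start G).toMove = 1 := by
  simp [Position.toMove, Position.start]

theorem Position.toMove_extend (h : Position G) (x : G) (hx hgen) :
    (h.extend x hx hgen).toMove = h.toMove + 1 := by
  simp [Position.toMove, Position.extend]

theorem Position.notMem_selected_of_notMem_span {h : Position G} {x : G} (hx : x ∉ h.span) :
    x ∉ h.selected :=
  fun hm => hx (Subgroup.subset_closure hm)

theorem Position.toMove_cases (h : Position G) : h.toMove = 1 ∨ h.toMove = 2 ∨ h.toMove = 0 := by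
  generalize h.toMove = p
  revert p
  decide

end Position

/-! ### Backward induction and subgame perfect equilibria -/

section Value

variable {G : Type*} [Group G] [Finite G]

/-- The winner under rational play, by backward induction: the player to move wins if she can move
to a position that she wins; otherwise she is the runner-up if she can move to a position won by the
next player; otherwise she loses. -/
noncomputable def value {G : Type*} [Group G] [Finite G] (h : Position G) : Player :=
  open Classical in
  if ∃ x hx hgen, value (h.extend x hx hgen) = h.toMove then h.toMove
  else if ∃ x hx hgen, value (h.extend x hx hgen) = h.toMove + 1 then h.toMove + 1
  else h.toMove - 1
termination_by Nat.card G - h.selected.length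
decreasing_by all_goals exact h.extend_measure_lt _ _ _

/-- Induction on positions, from the end of the game backwards. -/
theorem Position.backward_induction {motive : Position G → Prop}
    (step : ∀ h : Position G, (∀ x hx hgen, motive (h.extend x hx hgen)) → motive h)
    (h : Position G) : motive h := by
  induction hn : Nat.card G - h.selected.length using Nat.strong_induction_on generalizing h with
  | _ n ih =>
    subst hn
    exact step h fun x hx hgen => ih _ (h.extend_measure_lt x hx hgen) _ rfl

theorem payoff_value_extend_le (h : Position G) (x : G) (hx hgen) :
    payoff h.toMove (value (h.extend x hx hgen)) ≤ payoff h.toMove (value h) := by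
  conv_rhs => rw [value]
  split_ifs with h1 h2
  · rw [payoff_self]
    unfold payoff
    split_ifs <;> omega
  · rw [payoff_add_one]
    have : value (h.extend x hx hgen) ≠ h.toMove := fun e => h1 ⟨x, hx, hgen, e⟩
    unfold payoff
    split_ifs with h3 h4
    · exact absurd h3.symm this
    · exact le_rfl
    · exact Nat.zero_le _
  · rcases player_cases h.toMove (value (h.extend x hx hgen)) with e | e | e
    · exact absurd ⟨x, hx, hgen, e⟩ h1
    · exact absurd ⟨x, hx, hgen, e⟩ h2
    · rw [e]

/-- The value is attained by a move that does not end the game, unless there is no such move. -/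
theorem exists_value_extend_eq (h : Position G)
    (hmove : ∃ x, x ∉ h.selected ∧ Subgroup.closure {y | y ∈ x :: h.selected} ≠ ⊤) :
    ∃ x hx hgen, value (h.extend x hx hgen) = value h := by
  obtain ⟨x, hx, hgen⟩ := hmove
  by_cases h1 : ∃ x hx hgen, value (h.extend x hx hgen) = h.toMove
  · rw [value, if_pos h1]
    exact h1
  · by_cases h2 : ∃ x hx hgen, value (h.extend x hx hgen) = h.toMove + 1
    · rw [value, if_neg h1, if_pos h2]
      exact h2
    · rw [value, if_neg h1, if_neg h2]
      refine ⟨x, hx, hgen, ?_⟩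
      rcases player_cases h.toMove (value (h.extend x hx hgen)) with e | e | e
      · exact absurd ⟨x, hx, hgen, e⟩ h1
      · exact absurd ⟨x, hx, hgen, e⟩ h2
      · exact e

theorem value_eq_of_no_move (h : Position G)
    (hmove : ¬ ∃ x, x ∉ h.selected ∧ Subgroup.closure {y | y ∈ x :: h.selected} ≠ ⊤) :
    value h = h.toMove - 1 := by
  rw [value, if_neg, if_neg]
  · rintro ⟨x, hx, hgen, -⟩
    exact hmove ⟨x, hx, hgen⟩
  · rintro ⟨x, hx, hgen, -⟩
    exact hmove ⟨x, hx, hgen⟩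

theorem winner_of_generating (σ : Profile G) (h : Position G)
    (hgen : Subgroup.closure {y | y ∈ (σ h.toMove).move h :: h.selected} = ⊤) :
    winner σ h = h.toMove - 1 := by
  rw [winner, dif_pos hgen]

theorem winner_of_not_generating (σ : Profile G) (h : Position G)
    (hgen : Subgroup.closure {y | y ∈ (σ h.toMove).move h :: h.selected} ≠ ⊤) :
    winner σ h = winner σ (h.extend _ ((σ h.toMove).legal h) hgen) := by
  rw [winner, dif_neg hgen]

/-- If the move at `h` is to select `x`, the winner at `h` is the winner after that selection. -/
theorem winner_of_move_eq (σ : Profile G) (h : Position G) (x : G) (hx hgen)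
    (e : (σ h.toMove).move h = x) : winner σ h = winner σ (h.extend x hx hgen) := by
  subst e
  exact winner_of_not_generating σ h hgen

/-- All players follow one value-preserving choice `m`. A deviator never gains, since no move raises
the mover's payoff above that of `value`. -/
theorem exists_isRational (G : Type*) [Group G] [Finite G] : ∃ σ : Profile G, IsRational σ := by
  have hopt : ∀ h : Position G, ∃ x, x ∉ h.selected ∧
      (∀ hx hgen, value (h.extend x hx hgen) = value h) ∧
      (Subgroup.closure {y | y ∈ x :: h.selected} = ⊤ → value h = h.toMove - 1) := by
    intro h
    by_cases hmove : ∃ x, x ∉ h.selected ∧ Subgroup.closure {y | y ∈ x :: h.selected} ≠ ⊤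
    · obtain ⟨x, hx, hgen, e⟩ := exists_value_extend_eq h hmove
      exact ⟨x, hx, fun _ _ => e, fun h' => absurd h' hgen⟩
    · obtain ⟨x, hx⟩ := h.exists_notMem
      exact ⟨x, hx, fun hx hgen => absurd ⟨x, hx, hgen⟩ hmove, fun _ => value_eq_of_no_move h hmove⟩
  choose m hm hval hend using hopt
  let σ : Profile G := fun _ => ⟨m, hm⟩
  have hwin : ∀ h, winner σ h = value h := by
    refine Position.backward_induction fun h ih => ?_
    by_cases hgen : Subgroup.closure {y | y ∈ m h :: h.selected} = ⊤
    · rw [hend h hgen]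
      exact winner_of_generating σ h hgen
    · rw [← hval h (hm h) hgen, ← ih]
      exact winner_of_not_generating σ h hgen
  refine ⟨σ, fun h i τ => ?_⟩
  rw [hwin]
  refine Position.backward_induction
    (motive := fun h => payoff i (winner (Function.update σ i τ) h) ≤ payoff i (value h))
    (fun h ih => ?_) h
  by_cases hi : h.toMove = i
  · subst hi
    by_cases hgen : Subgroup.closure
        {y | y ∈ (Function.update σ h.toMove τ h.toMove).move h :: h.selected} = ⊤
    · rw [winner_of_generating _ h hgen, payoff_sub_one]
      exact Nat.zero_le _
    · rw [winner_of_not_generating _ h hgen]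
      exact (ih _ _ _).trans (payoff_value_extend_le h _ _ _)
  · have hmv : (Function.update σ i τ h.toMove).move h = m h := by
      rw [Function.update_of_ne hi]
    by_cases hgen : Subgroup.closure {y | y ∈ m h :: h.selected} = ⊤
    · rw [winner_of_generating _ h (by rwa [hmv]), hend h hgen]
    · rw [winner_of_move_eq _ h (m h) (hm h) hgen hmv, ← hval h (hm h) hgen]
      exact ih _ _ _

/-- The winner depends only on the choices at the positions that are still to come. -/
theorem winner_congr {σ τ : Profile G} (n : ℕ)
    (hστ : ∀ (i : Player) (h : Position G), n ≤ h.selected.length → (σ i).move h = (τ i).move h)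
    (h : Position G) (hn : n ≤ h.selected.length) : winner σ h = winner τ h := by
  revert hn
  refine Position.backward_induction
    (motive := fun h => n ≤ h.selected.length → winner σ h = winner τ h) (fun h ih hn => ?_) h
  by_cases hgen : Subgroup.closure {y | y ∈ (τ h.toMove).move h :: h.selected} = ⊤
  · rw [winner_of_generating τ h hgen, winner_of_generating σ h (by rwa [hστ _ h hn])]
  · rw [winner_of_not_generating τ h hgen,
      winner_of_move_eq σ h _ ((τ h.toMove).legal h) hgen (hστ _ h hn)]
    exact ih _ _ _ (hn.trans (Nat.le_succ _))

/-- Rationality is tested against the deviation that changes the mover's strategy at `h` only. -/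
theorem IsRational.payoff_extend_le {σ : Profile G} (hσ : IsRational σ) (h : Position G) (x : G)
    (hx hgen) : payoff h.toMove (winner σ (h.extend x hx hgen)) ≤
      payoff h.toMove (winner σ h) := by
  classical
  let τ : Strategy G := ⟨Function.update (σ h.toMove).move h x, fun h' => by
    by_cases e : h' = h
    · subst e
      rwa [Function.update_self]
    · rw [Function.update_of_ne e]
      exact (σ _).legal h'⟩
  have hmv : (Function.update σ h.toMove τ h.toMove).move h = x := by
    rw [Function.update_self]
    exact Function.update_self h x (σ h.toMove).move
  have := hσ h h.toMove τ
  rw [winner_of_move_eq _ h x hx hgen hmv] at this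
  refine le_of_eq_of_le (congrArg _ ?_) this
  -- Every later position is longer than `h`, so the altered choice is never met again.
  refine winner_congr (h.selected.length + 1) (fun i h' hlen => ?_) _ le_rfl
  by_cases hi : i = h.toMove
  · subst hi
    rw [Function.update_self]
    refine (Function.update_of_ne ?_ _ _).symm
    rintro rfl
    omega
  · rw [Function.update_of_ne hi]

theorem IsRational.winner_eq_value {σ : Profile G} (hσ : IsRational σ) (h : Position G) :
    winner σ h = value h := by
  refine Position.backward_induction (motive := fun h => winner σ h = value h) (fun h ih => ?_) h
  apply payoff_injective h.toMove
  apply le_antisymm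
  · by_cases hgen : Subgroup.closure {y | y ∈ (σ h.toMove).move h :: h.selected} = ⊤
    · rw [winner_of_generating σ h hgen, payoff_sub_one]
      exact Nat.zero_le _
    · rw [winner_of_not_generating σ h hgen, ih]
      exact payoff_value_extend_le h _ _ _
  · by_cases hmove : ∃ x, x ∉ h.selected ∧ Subgroup.closure {y | y ∈ x :: h.selected} ≠ ⊤
    · obtain ⟨x, hx, hgen, e⟩ := exists_value_extend_eq h hmove
      rw [← e, ← ih]
      exact hσ.payoff_extend_le h x hx hgen
    · rw [value_eq_of_no_move h hmove, payoff_sub_one]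
      exact Nat.zero_le _

theorem hasWinningStrategy_of_value [Nontrivial G] {i : Player}
    (h : value (Position.start G) = i) : HasWinningStrategy G i :=
  ⟨exists_isRational G, fun _ hσ => (hσ.winner_eq_value _).trans h⟩

/-- A game ends when some maximal subgroup has been exhausted, and its order modulo `3` determines
the winner. -/
theorem exists_isCoatom_value (h : Position G) :
    ∃ M : Subgroup G, IsCoatom M ∧ h.span ≤ M ∧ value h = (Nat.card M : ZMod 3) := by
  refine Position.backward_induction (motive := fun h => ∃ M : Subgroup G, IsCoatom M ∧
    h.span ≤ M ∧ value h = (Nat.card M : ZMod 3)) (fun h ih => ?_) h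
  by_cases hmove : ∃ x, x ∉ h.selected ∧ Subgroup.closure {y | y ∈ x :: h.selected} ≠ ⊤
  · obtain ⟨x, hx, hgen, e⟩ := exists_value_extend_eq h hmove
    obtain ⟨M, hM, hle, hv⟩ := ih x hx hgen
    rw [h.span_extend] at hle
    exact ⟨M, hM, le_sup_left.trans hle, e ▸ hv⟩
  · rw [value_eq_of_no_move h hmove]
    obtain ⟨M, hM, hle⟩ := (eq_top_or_exists_le_coatom h.span).resolve_left h.not_generating
    refine ⟨M, hM, hle, ?_⟩
    -- An unselected element of `M` would be a move that does not end the game.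
    have hset : (M : Set G) = {x | x ∈ h.selected} := by
      refine Set.Subset.antisymm (fun x hx => ?_) (fun x hx => hle (Subgroup.subset_closure hx))
      by_contra hns
      refine hmove ⟨x, hns, fun htop => hM.1 (top_le_iff.1 ?_)⟩
      rw [← htop, closure_cons]
      exact sup_le hle ((Subgroup.closure_le M).2 (Set.singleton_subset_iff.2 hx))
    have hcard : Nat.card M = h.selected.length := by
      classical
      have h1 : (M : Set G) = (h.selected.toFinset : Set G) := by
        rw [hset]
        ext x
        simp
      rw [← List.toFinset_card_of_nodup h.nodup, ← Set.ncard_coe_finset, ← h1]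
      rfl
    -- After `|M|` selections the mover, who loses, is `|M| + 1`; the winner sits one place before.
    rw [hcard, Position.toMove, add_sub_cancel_right]

/-- Every selection makes at most one step of progress. -/
theorem relRank_span_extend (A : Subgroup G) (h : Position G)
    (x : G) (hx hgen) : relRank A (h.extend x hx hgen).span ≤ relRank A h.span ∧
      relRank A h.span ≤ relRank A (h.extend x hx hgen).span + 1 := by
  rw [h.span_extend]
  exact ⟨relRank_anti A le_sup_left, relRank_le_succ A _ x⟩

theorem value_eq_of_forall_isCoatom {h : Position G} {u : Player}
    (hu : ∀ M : Subgroup G, IsCoatom M → h.span ≤ M → (Nat.card M : ZMod 3) = u) :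
    value h = u := by
  obtain ⟨M, hM, hle, hv⟩ := exists_isCoatom_value h
  exact hv.trans (hu M hM hle)

/-- If every move that does not end the game leads to a win of `u`, and there is such a move, then
`u` wins. -/
theorem value_eq_of_forall_extend {h : Position G} {u : Player}
    (hmove : ∃ x, x ∉ h.selected ∧ Subgroup.closure {y | y ∈ x :: h.selected} ≠ ⊤)
    (hu : ∀ x hx hgen, value (h.extend x hx hgen) = u) : value h = u := by
  obtain ⟨x, hx, hgen, e⟩ := exists_value_extend_eq h hmove
  exact e.symm.trans (hu x hx hgen)

end Value

/-! ### The race between two complementary factors -/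

/-- The group is the product of `A` and `B`; if `A` is generated first, `a` wins, and if `B` is
generated first, `b` wins. -/
structure IsRace {G : Type*} [Group G] (A B : Subgroup G) (a b : Player) : Prop where
  split : Nonempty (PowerSplit A B)
  card_of_le_left : ∀ M : Subgroup G, IsCoatom M → A ≤ M → (Nat.card M : ZMod 3) = a
  card_of_le_right : ∀ M : Subgroup G, IsCoatom M → B ≤ M → (Nat.card M : ZMod 3) = b

namespace IsRace

variable {G : Type*} [Group G] {A B : Subgroup G} {a b : Player}

theorem symm (r : IsRace A B a b) : IsRace B A b a :=
  ⟨r.split.map PowerSplit.symm, r.card_of_le_right, r.card_of_le_left⟩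

variable [Finite G]

theorem value_of_relRank_eq_zero (r : IsRace A B a b) {h : Position G}
    (hA : relRank A h.span = 0) : value h = a :=
  value_eq_of_forall_isCoatom fun M hM hle =>
    r.card_of_le_left M hM ((relRank_eq_zero.1 hA).trans hle)

theorem value_eq_or (r : IsRace A B a b) (h : Position G) : value h = a ∨ value h = b := by
  obtain ⟨M, hM, hle, hv⟩ := exists_isCoatom_value h
  obtain ⟨s⟩ := r.split
  rw [hv]
  exact (s.le_or_le_of_isCoatom hM).imp (r.card_of_le_left M hM) (r.card_of_le_right M hM)

theorem relRank_pos_or (r : IsRace A B a b) (h : Position G) :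
    0 < relRank A h.span ∨ 0 < relRank B h.span := by
  obtain ⟨s⟩ := r.split
  by_contra! hc
  exact h.not_generating (s.eq_top_of_le (relRank_eq_zero.1 (Nat.le_zero.1 hc.1))
    (relRank_eq_zero.1 (Nat.le_zero.1 hc.2)))

/-- While both factors are incomplete, the player to move can make progress in the first factor
without changing the second. -/
theorem exists_extend (r : IsRace A B a b) (h : Position G) (hA : 0 < relRank A h.span)
    (hB : 0 < relRank B h.span) :
    ∃ x hx hgen, relRank A (h.extend x hx hgen).span < relRank A h.span ∧
      relRank B (h.extend x hx hgen).span = relRank B h.span := by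
  obtain ⟨s⟩ := r.split
  obtain ⟨x, hxA, hlt⟩ := s.exists_relRank_lt hA
  have hBx : relRank B (h.span ⊔ Subgroup.closure {x}) = relRank B h.span :=
    s.symm.relRank_sup hxA h.span
  have hx : x ∉ h.selected := by
    apply Position.notMem_selected_of_notMem_span
    intro hmem
    rw [sup_eq_left.2 ((Subgroup.closure_le _).2 (Set.singleton_subset_iff.2 hmem))] at hlt
    exact lt_irrefl _ hlt
  have hgen : Subgroup.closure {y | y ∈ x :: h.selected} ≠ ⊤ := by
    rw [closure_cons]
    intro htop
    rw [htop, relRank_eq_zero.2 le_top] at hBx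
    omega
  refine ⟨x, hx, hgen, ?_⟩
  rw [h.span_extend]
  exact ⟨hlt, hBx⟩

/-- A player who prefers `a` to `b` plays for `A`. -/
theorem value_of_preferred (r : IsRace A B a b) {h : Position G}
    (hp : payoff h.toMove b < payoff h.toMove a) {x : G} {hx hgen}
    (hv : value (h.extend x hx hgen) = a) : value h = a := by
  refine (r.value_eq_or h).resolve_right fun e => ?_
  have := payoff_value_extend_le h x hx hgen
  rw [hv, e] at this
  omega

/-- One step of the race by a player who prefers `a`. -/
theorem value_of_step (r : IsRace A B a b) {h : Position G}
    (hp : payoff h.toMove b < payoff h.toMove a) (hB : 0 < relRank B h.span)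
    (hstep : 0 < relRank A h.span → ∀ x hx hgen,
      relRank A (h.extend x hx hgen).span < relRank A h.span →
      relRank B (h.extend x hx hgen).span = relRank B h.span →
      value (h.extend x hx hgen) = a) : value h = a := by
  rcases Nat.eq_zero_or_pos (relRank A h.span) with hA | hA
  · exact r.value_of_relRank_eq_zero hA
  · obtain ⟨x, hx, hgen, h1, h2⟩ := r.exists_extend h hA hB
    exact r.value_of_preferred hp (hstep hA x hx hgen h1 h2)

/-- If whatever the player to move selects lets `a` win, then `a` wins. -/
theorem value_of_forall (r : IsRace A B a b) {h : Position G} (hB : 0 < relRank B h.span)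
    (hstep : 0 < relRank A h.span → ∀ x hx hgen, value (h.extend x hx hgen) = a) :
    value h = a := by
  rcases Nat.eq_zero_or_pos (relRank A h.span) with hA | hA
  · exact r.value_of_relRank_eq_zero hA
  · obtain ⟨x, hx, hgen, -⟩ := r.exists_extend h hA hB
    exact value_eq_of_forall_extend ⟨x, hx, hgen⟩ (hstep hA)

end IsRace

/-! ### Who wins the race -/

namespace IsRace

variable {G : Type*} [Group G] [Finite G] {A B : Subgroup G}

/-- Players 3 and 1 together are fast enough to generate `A` before Player 2 has generated `B`. -/
theorem value_eq_one (r : IsRace A B 1 2) (h : Position G)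
    (h1 : h.toMove = 1 → relRank A h.span + 1 ≤ 2 * relRank B h.span)
    (h2 : h.toMove = 2 → relRank A h.span + 2 ≤ 2 * relRank B h.span)
    (h3 : h.toMove = 0 → relRank A h.span ≤ 2 * relRank B h.span) : value h = 1 := by
  -- The slacks 1, 2, 0 form an invariant: Players 1 and 3 each lower the `A` count, and Player 2
  -- can cost at most 2 by lowering the `B` count.
  induction h using Position.backward_induction with
  | step h ih =>
    -- On Player 3's turn the inequality allows both counts to be zero; this excludes it.
    have hpos := r.relRank_pos_or h
    rcases h.toMove_cases with ht | ht | ht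
    · have := h1 ht
      refine r.value_of_step (by rw [ht]; decide) (by omega) fun _ x hx hgen hA hB => ?_
      have hm : (h.extend x hx hgen).toMove = 2 := by rw [h.toMove_extend, ht]; decide
      refine ih x hx hgen (fun e => ?_) (fun _ => by omega) (fun e => ?_)
      · exact absurd (hm.symm.trans e) (by decide)
      · exact absurd (hm.symm.trans e) (by decide)
    · have := h2 ht
      refine r.value_of_forall (by omega) fun _ x hx hgen => ?_
      have hA := relRank_span_extend A h x hx hgen
      have hB := relRank_span_extend B h x hx hgen
      have hm : (h.extend x hx hgen).toMove = 0 := by rw [h.toMove_extend, ht]; decide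
      refine ih x hx hgen (fun e => ?_) (fun e => ?_) (fun _ => by omega)
      · exact absurd (hm.symm.trans e) (by decide)
      · exact absurd (hm.symm.trans e) (by decide)
    · have := h3 ht
      refine r.value_of_step (by rw [ht]; decide) (by omega) fun _ x hx hgen hA hB => ?_
      have hm : (h.extend x hx hgen).toMove = 1 := by rw [h.toMove_extend, ht]; decide
      refine ih x hx hgen (fun _ => by omega) (fun e => ?_) (fun e => ?_)
      · exact absurd (hm.symm.trans e) (by decide)
      · exact absurd (hm.symm.trans e) (by decide)

/-- Player 2 alone is fast enough to generate `B` before Players 3 and 1 have generated `A`. -/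
theorem value_eq_two (r : IsRace A B 1 2) (h : Position G)
    (h1 : h.toMove = 1 → 2 * relRank B h.span ≤ relRank A h.span)
    (h2 : h.toMove = 2 → 2 * relRank B h.span ≤ relRank A h.span + 1)
    (h3 : h.toMove = 0 → 2 * relRank B h.span + 1 ≤ relRank A h.span) : value h = 2 := by
  induction h using Position.backward_induction with
  | step h ih =>
    have hpos := r.relRank_pos_or h
    rcases h.toMove_cases with ht | ht | ht
    · have := h1 ht
      refine r.symm.value_of_forall (by omega) fun _ x hx hgen => ?_
      have hA := relRank_span_extend A h x hx hgen
      have hB := relRank_span_extend B h x hx hgen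
      have hm : (h.extend x hx hgen).toMove = 2 := by rw [h.toMove_extend, ht]; decide
      refine ih x hx hgen (fun e => ?_) (fun _ => by omega) (fun e => ?_)
      · exact absurd (hm.symm.trans e) (by decide)
      · exact absurd (hm.symm.trans e) (by decide)
    · have := h2 ht
      refine r.symm.value_of_step (by rw [ht]; decide) (by omega) fun _ x hx hgen hB hA => ?_
      have hm : (h.extend x hx hgen).toMove = 0 := by rw [h.toMove_extend, ht]; decide
      refine ih x hx hgen (fun e => ?_) (fun e => ?_) (fun _ => by omega)
      · exact absurd (hm.symm.trans e) (by decide)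
      · exact absurd (hm.symm.trans e) (by decide)
    · have := h3 ht
      refine r.symm.value_of_forall (by omega) fun _ x hx hgen => ?_
      have hA := relRank_span_extend A h x hx hgen
      have hB := relRank_span_extend B h x hx hgen
      have hm : (h.extend x hx hgen).toMove = 1 := by rw [h.toMove_extend, ht]; decide
      refine ih x hx hgen (fun _ => by omega) (fun e => ?_) (fun e => ?_)
      · exact absurd (hm.symm.trans e) (by decide)
      · exact absurd (hm.symm.trans e) (by decide)

variable {a b : Player}

/-- A player who prefers `a` secures it if a single selection completes `A`. -/
theorem value_of_relRank_le_one (r : IsRace A B a b) {h : Position G}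
    (hp : payoff h.toMove b < payoff h.toMove a) (hA : relRank A h.span ≤ 1)
    (hB : 0 < relRank B h.span) : value h = a :=
  r.value_of_step hp hB fun _ _ _ _ hlt _ => r.value_of_relRank_eq_zero (by omega)

section Start

variable [Nontrivial G]

theorem hasWinningStrategy_one (r : IsRace A B 1 2) (h : Group.rank A + 1 ≤ 2 * Group.rank B) :
    HasWinningStrategy G 1 := by
  obtain ⟨s⟩ := r.split
  rw [← s.relRank_bot, ← s.symm.relRank_bot] at h
  apply hasWinningStrategy_of_value
  have ht := Position.toMove_start (G := G)
  refine r.value_eq_one _ (fun _ => ?_) (fun e => ?_) (fun e => ?_)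
  · rwa [Position.span_start]
  · exact absurd (ht.symm.trans e) (by decide)
  · exact absurd (ht.symm.trans e) (by decide)

theorem hasWinningStrategy_two (r : IsRace A B 1 2) (h : 2 * Group.rank B ≤ Group.rank A) :
    HasWinningStrategy G 2 := by
  obtain ⟨s⟩ := r.split
  rw [← s.relRank_bot, ← s.symm.relRank_bot] at h
  apply hasWinningStrategy_of_value
  have ht := Position.toMove_start (G := G)
  refine r.value_eq_two _ (fun _ => ?_) (fun e => ?_) (fun e => ?_)
  · rwa [Position.span_start]
  · exact absurd (ht.symm.trans e) (by decide)
  · exact absurd (ht.symm.trans e) (by decide)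

/-- Player 1 completes `A` at once. -/
theorem hasWinningStrategy_one_of_relRank_le_one (r : IsRace A B 1 0)
    (hA : relRank A ⊥ ≤ 1) (hB : 0 < relRank B ⊥) : HasWinningStrategy G 1 := by
  apply hasWinningStrategy_of_value
  refine r.value_of_relRank_le_one ?_ ?_ ?_
  · rw [Position.toMove_start]; decide
  · rwa [Position.span_start]
  · rwa [Position.span_start]

/-- Players 1 and 2 complete `A` together. -/
theorem hasWinningStrategy_two_of_relRank_le_two (r : IsRace A B 2 0)
    (hA : relRank A ⊥ ≤ 2) (hB : 0 < relRank B ⊥) : HasWinningStrategy G 2 := by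
  rw [← Position.span_start] at hA hB
  apply hasWinningStrategy_of_value
  refine r.value_of_step ?_ hB fun _ x hx hgen h1 h2 => ?_
  · rw [Position.toMove_start]; decide
  · refine r.value_of_relRank_le_one ?_ (by omega) (by omega)
    rw [Position.toMove_extend, Position.toMove_start]; decide

/-- Player 2 completes `B` after Player 1 has failed to complete `A`. -/
theorem hasWinningStrategy_three_of_two_le_relRank (r : IsRace A B 1 0)
    (hA : 2 ≤ relRank A ⊥) (hB : relRank B ⊥ ≤ 1) : HasWinningStrategy G 3 := by
  rw [← Position.span_start] at hA hB
  apply hasWinningStrategy_of_value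
  refine r.symm.value_of_forall (by omega) fun _ x hx hgen => ?_
  have h1 := relRank_span_extend A _ x hx hgen
  have h2 := relRank_span_extend B _ x hx hgen
  refine r.symm.value_of_relRank_le_one ?_ (by omega) (by omega)
  rw [Position.toMove_extend, Position.toMove_start]; decide

/-- Player 3 completes `B` after Players 1 and 2 have failed to complete `A`. -/
theorem hasWinningStrategy_three_of_three_le_relRank (r : IsRace A B 2 0)
    (hA : 3 ≤ relRank A ⊥) (hB : relRank B ⊥ ≤ 1) : HasWinningStrategy G 3 := by
  rw [← Position.span_start] at hA hB
  apply hasWinningStrategy_of_value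
  refine r.symm.value_of_forall (by omega) fun _ x hx hgen => ?_
  have h1 := relRank_span_extend A _ x hx hgen
  have h2 := relRank_span_extend B _ x hx hgen
  refine r.symm.value_of_forall (by omega) fun _ y hy hgen' => ?_
  have h3 := relRank_span_extend A _ y hy hgen'
  have h4 := relRank_span_extend B _ y hy hgen'
  refine r.symm.value_of_relRank_le_one ?_ (by omega) (by omega)
  rw [Position.toMove_extend, Position.toMove_extend, Position.toMove_start]; decide

end Start

end IsRace

/-! ### Races in nilpotent groups, by the order modulo 3 and 9 -/

section Nilpotent

variable {G : Type*} [Group G] [Finite G]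

theorem relRank_bot_le_rank (A : Subgroup G) : relRank A ⊥ ≤ Group.rank G := by
  obtain ⟨T, hT, htop⟩ := Group.rank_spec G
  rw [← hT]
  exact relRank_le T (by rw [htop, bot_sup_eq]; exact le_top)

/-- If the second factor is cyclic, it does not need a generator of its own. -/
theorem PowerSplit.rank_le {A B : Subgroup G} (s : PowerSplit A B) (hB : relRank B ⊥ ≤ 1) :
    Group.rank G ≤ max (relRank A ⊥) 1 := by
  classical
  obtain ⟨T, hT, hTA, hA⟩ := s.exists_relRank_subset ⊥
  obtain ⟨U, hU, hUB, hBU⟩ := s.symm.exists_relRank_subset ⊥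
  rw [bot_sup_eq] at hA hBU
  obtain ⟨p, hp, hBp⟩ : ∃ p ∈ B, B ≤ Subgroup.closure {p} := by
    rcases Finset.card_le_one_iff_subset_singleton.1 (hU.trans hB) with ⟨p, hUp⟩
    rcases Finset.subset_singleton_iff.1 hUp with rfl | rfl
    · refine ⟨1, B.one_mem, hBU.trans ?_⟩
      simp
    · exact ⟨p, hUB (by simp), by simpa using hBU⟩
  -- If `A` is trivial, `p` alone generates `G`, hence the 1 in the maximum. Otherwise `p` is
  -- absorbed into one generator `t * p`, from which the projection recovers `t`.
  rcases T.eq_empty_or_nonempty with rfl | ⟨t, ht⟩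
  · refine le_trans ?_ (le_max_right _ _)
    rw [← Finset.card_singleton p]
    refine Group.rank_le (s.eq_top_of_le (hA.trans ?_) (by simpa using hBp))
    simp
  · refine le_trans ?_ (le_max_left _ _)
    refine le_trans ?_ hT
    have hcard : (insert (t * p) (T.erase t)).card ≤ T.card := by
      refine (Finset.card_insert_le _ _).trans ?_
      rw [Finset.card_erase_add_one ht]
    refine le_trans (Group.rank_le ?_) hcard
    set D := Subgroup.closure ((insert (t * p) (T.erase t) : Finset G) : Set G) with hD
    have htp : t * p ∈ D := Subgroup.subset_closure (by simp)
    have htD : t ∈ D := by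
      have := s.map_fst_le D ⟨t * p, htp, rfl⟩
      rwa [map_mul, s.fst_eq_self (hTA ht), s.fst_eq_one p hp, mul_one] at this
    have hpD : p ∈ D := by
      have := D.mul_mem (D.inv_mem htD) htp
      rwa [inv_mul_cancel_left] at this
    refine s.eq_top_of_le (hA.trans ((Subgroup.closure_le D).2 fun y hy => ?_))
      (hBp.trans ((Subgroup.closure_le D).2 (Set.singleton_subset_iff.2 hpD)))
    by_cases hyt : y = t
    · rwa [hyt]
    · refine Subgroup.subset_closure ?_
      rw [Finset.coe_insert]
      exact Or.inr (Finset.mem_coe.2 (Finset.mem_erase.2 ⟨hyt, hy⟩))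

variable [Group.IsNilpotent G]

/-- A maximal subgroup containing one Hall factor has its index in the other class of primes, hence
the crossed hypotheses on `m`. -/
theorem isRace_hallProduct {c c' : ℕ → Prop} {a b : Player}
    (hc : ∀ q : ℕ, q.Prime → q ∣ Nat.card G → (c' q ↔ ¬ c q))
    (ha : ∀ m q : ℕ, q.Prime → c' q → m * q = Nat.card G → (m : ZMod 3) = a)
    (hb : ∀ m q : ℕ, q.Prime → c q → m * q = Nat.card G → (m : ZMod 3) = b) :
    IsRace (hallProduct G c) (hallProduct G c') a b := by
  refine ⟨nonempty_powerSplit_hallProduct hc, fun M hM hle => ?_, fun M hM hle => ?_⟩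
  · have hp := prime_index_of_isCoatom hM
    exact ha _ _ hp ((hc _ hp M.index_dvd_card).2 (not_index_of_hallProduct_le hM hle))
      M.card_mul_index
  · have hp := prime_index_of_isCoatom hM
    refine hb _ _ hp ?_ M.card_mul_index
    by_contra hn
    exact not_index_of_hallProduct_le hM hle ((hc _ hp M.index_dvd_card).2 hn)

theorem natCast_eq_of_mul_eq {m q n : ℕ} (h : m * q = n) {i j k : ℕ} (hq : q ≡ i [MOD 3])
    (hn : n ≡ j [MOD 3]) (hij : ∀ x : ZMod 3, x * i = j → x = k) : (m : ZMod 3) = (k : ZMod 3) := by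
  rw [← ZMod.natCast_eq_natCast_iff] at hq hn
  refine hij _ ?_
  rw [← hq, ← hn, ← h, Nat.cast_mul]

theorem modEq_two_iff_not_modEq_one {n q : ℕ} (hn : ¬ 3 ∣ n) (hd : q ∣ n) :
    q ≡ 2 [MOD 3] ↔ ¬ q ≡ 1 [MOD 3] := by
  have : ¬ 3 ∣ q := fun h => hn (h.trans hd)
  unfold Nat.ModEq
  omega

theorem isRace_of_card_modEq_one (h : Nat.card G ≡ 1 [MOD 3]) :
    IsRace (sylowProduct G 2) (sylowProduct G 1) 1 2 := by
  have h3 : ¬ 3 ∣ Nat.card G := by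
    unfold Nat.ModEq at h
    omega
  refine (isRace_hallProduct (c := (· ≡ 1 [MOD 3])) (c' := (· ≡ 2 [MOD 3]))
    (fun q _ hd => modEq_two_iff_not_modEq_one h3 hd) (fun m q _ hq e => ?_)
    (fun m q _ hq e => ?_)).symm
  · exact natCast_eq_of_mul_eq (k := 2) e hq h (by decide)
  · simpa using natCast_eq_of_mul_eq (k := 1) e hq h (by decide)

theorem isRace_of_card_modEq_two (h : Nat.card G ≡ 2 [MOD 3]) :
    IsRace (sylowProduct G 1) (sylowProduct G 2) 1 2 := by
  have h3 : ¬ 3 ∣ Nat.card G := by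
    unfold Nat.ModEq at h
    omega
  refine isRace_hallProduct (c := (· ≡ 1 [MOD 3])) (c' := (· ≡ 2 [MOD 3]))
    (fun q _ hd => modEq_two_iff_not_modEq_one h3 hd) (fun m q _ hq e => ?_)
    (fun m q _ hq e => ?_)
  · simpa using natCast_eq_of_mul_eq (k := 1) e hq h (by decide)
  · exact natCast_eq_of_mul_eq (k := 2) e hq h (by decide)

theorem natCast_eq_zero_of_mul_eq {m q n : ℕ} (hq : q.Prime) (hq3 : q ≠ 3) (hn : 3 ∣ n)
    (h : m * q = n) : (m : ZMod 3) = 0 := by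
  rw [ZMod.natCast_eq_zero_iff]
  rcases (Nat.prime_three.dvd_mul).1 (h ▸ hn) with h | h
  · exact h
  · exact absurd ((Nat.prime_dvd_prime_iff_eq Nat.prime_three hq).1 h).symm hq3

theorem isRace_of_card_modEq_nine {k : ℕ} (h : Nat.card G ≡ 3 * k [MOD 9]) :
    IsRace (hallProduct G (· ≠ 3)) (hallProduct G (· = 3)) k 0 := by
  unfold Nat.ModEq at h
  refine isRace_hallProduct (fun q _ _ => not_not.symm) (fun m q _ hq e => ?_)
    (fun m q hp hq e => natCast_eq_zero_of_mul_eq hp hq (by omega) e)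
  -- Here the index is 3, and `3 * m ≡ 3 * k` modulo 9 gives `m ≡ k` modulo 3.
  rw [ZMod.natCast_eq_natCast_iff, Nat.ModEq]
  subst hq
  omega

theorem relRank_hallProduct_three {n : ℕ} (hn : Nat.card G = 3 * n) (h3 : ¬ 3 ∣ n) :
    relRank (hallProduct G (· = 3)) ⊥ = 1 := by
  have := Fact.mk Nat.prime_three
  let P : Sylow 3 G := default
  have hcard : Nat.card P = 3 := by
    have hn0 : n ≠ 0 := by
      rintro rfl
      exact h3 (dvd_zero 3)
    rw [P.card_eq_multiplicity, hn, Nat.factorization_mul (by norm_num) hn0, Finsupp.add_apply,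
      Nat.prime_three.factorization_self, Nat.factorization_eq_zero_of_not_dvd h3]
    norm_num
  have hle : hallProduct G (· = 3) ≤ P := by
    refine hallProduct_le fun q _ hq Q => ?_
    subst hq
    have := Sylow.unique_of_normal P inferInstance
    rw [Subsingleton.elim Q P]
  apply le_antisymm
  · have hcyc : IsCyclic P := isCyclic_of_prime_card hcard
    obtain ⟨g, hg⟩ := hcyc.exists_generator
    rw [← Finset.card_singleton (g : G)]
    refine relRank_le _ (hle.trans fun x hx => ?_)
    obtain ⟨k, hk⟩ := hg ⟨x, hx⟩
    rw [bot_sup_eq, Finset.coe_singleton, Subgroup.mem_closure_singleton]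
    exact ⟨k, congrArg Subtype.val hk⟩
  · rw [Nat.one_le_iff_ne_zero, Ne, relRank_eq_zero]
    intro hbot
    have hP : (P : Subgroup G) = ⊥ :=
      le_bot_iff.1 ((sylow_le_hallProduct (c := (· = 3)) Nat.prime_three rfl P).trans hbot)
    have : Nat.card (P : Subgroup G) = 1 := by rw [hP, Subgroup.card_bot]
    exact absurd (hcard.symm.trans this) (by norm_num)

theorem hasWinningStrategy_three_of_nine_dvd [Nontrivial G] (h : 9 ∣ Nat.card G) :
    HasWinningStrategy G 3 := by
  apply hasWinningStrategy_of_value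
  refine value_eq_of_forall_isCoatom fun M hM _ => ?_
  have hp := prime_index_of_isCoatom hM
  have hmul := M.card_mul_index
  by_cases h3 : M.index = 3
  · rw [h3] at hmul
    have : 3 ∣ Nat.card M := by omega
    exact (ZMod.natCast_eq_zero_iff _ _).2 this
  · exact natCast_eq_zero_of_mul_eq hp h3 (by omega) hmul

end Nilpotent

end DoNotGenerate

open DoNotGenerate in
theorem mainTheorem1 (G : Type*) [Group G] [Finite G] [Nontrivial G] [Group.IsNilpotent G]
    (H K : Subgroup G) (hH : H = sylowProduct G 1) (hK : K = sylowProduct G 2) :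
    ((Nat.card G ≡ 1 [MOD 3] ∧ 2 * Group.rank H ≥ Group.rank K + 1 ∨
      Nat.card G ≡ 2 [MOD 3] ∧ 2 * Group.rank K ≥ Group.rank H + 1 ∨
      Nat.card G ≡ 3 [MOD 9] ∧ Group.rank G = 1) → HasWinningStrategy G 1) ∧
    ((Nat.card G ≡ 1 [MOD 3] ∧ 2 * Group.rank H < Group.rank K + 1 ∨
      Nat.card G ≡ 2 [MOD 3] ∧ 2 * Group.rank K < Group.rank H + 1 ∨
      Nat.card G ≡ 6 [MOD 9] ∧ Group.rank G ≤ 2) → HasWinningStrategy G 2) ∧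
    ((Nat.card G ≡ 0 [MOD 9] ∨
      Nat.card G ≡ 3 [MOD 9] ∧ Group.rank G ≥ 2 ∨
      Nat.card G ≡ 6 [MOD 9] ∧ Group.rank G ≥ 3) → HasWinningStrategy G 3) := by
  subst hH hK
  have hrank := relRank_bot_le_rank (hallProduct G (· ≠ 3))
  have hthree : Nat.card G ≡ 3 [MOD 9] ∨ Nat.card G ≡ 6 [MOD 9] →
      relRank (hallProduct G (· = 3)) ⊥ = 1 := by
    unfold Nat.ModEq
    intro h
    exact relRank_hallProduct_three (n := Nat.card G / 3) (by omega) (by omega)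
  have hone : Nat.card G ≡ 3 [MOD 9] →
      IsRace (hallProduct G (· ≠ 3)) (hallProduct G (· = 3)) 1 0 := fun h => by
    simpa using isRace_of_card_modEq_nine (k := 1) h
  have htwo : Nat.card G ≡ 6 [MOD 9] →
      IsRace (hallProduct G (· ≠ 3)) (hallProduct G (· = 3)) 2 0 :=
    isRace_of_card_modEq_nine (k := 2)
  refine ⟨?_, ?_, ?_⟩
  · rintro (⟨h, hr⟩ | ⟨h, hr⟩ | ⟨h, hr⟩)
    · exact (isRace_of_card_modEq_one h).hasWinningStrategy_one hr
    · exact (isRace_of_card_modEq_two h).hasWinningStrategy_one hr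
    · exact (hone h).hasWinningStrategy_one_of_relRank_le_one (hr ▸ hrank)
        ((hthree (Or.inl h)).symm ▸ one_pos)
  · rintro (⟨h, hr⟩ | ⟨h, hr⟩ | ⟨h, hr⟩)
    · exact (isRace_of_card_modEq_one h).hasWinningStrategy_two (Nat.lt_succ_iff.1 hr)
    · exact (isRace_of_card_modEq_two h).hasWinningStrategy_two (Nat.lt_succ_iff.1 hr)
    · exact (htwo h).hasWinningStrategy_two_of_relRank_le_two (hrank.trans hr)
        ((hthree (Or.inr h)).symm ▸ one_pos)
  · rintro (h | ⟨h, hr⟩ | ⟨h, hr⟩)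
    · exact hasWinningStrategy_three_of_nine_dvd ((Nat.modEq_zero_iff_dvd).1 h)
    · obtain ⟨s⟩ := (hone h).split
      have hB := (hthree (Or.inl h)).le
      have := s.rank_le hB
      -- The cyclic 3-part needs no generator of its own, so the bound on `Group.rank G` passes to
      -- the other factor.
      exact (hone h).hasWinningStrategy_three_of_two_le_relRank (by omega) hB
    · obtain ⟨s⟩ := (htwo h).split
      have hB := (hthree (Or.inr h)).le
      have := s.rank_le hB
      exact (htwo h).hasWinningStrategy_three_of_three_le_relRank (by omega) hB
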